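/- Fix a finite set $D$ and a function $f : D \times D \to D$ that is a commutative group operation on $D$ (associative, commutative, with an identity element and inverses). Let $\langle f\rangle$ be the functional clone generated by $f$, i.e. the set of all finitary operations on $D$ obtained by composition from $f$ and the projections $\pi^n_k : D^n \to D$, $\pi^n_k(x_1,\dots,x_n) = x_k$. Operations on $D$ act coefficient-wise on vectors over $D$ of a common size $n$. For a set $\mathcal F$ of operations on $D$ and a set $\mathcal S \subseteq D^n$, put $\mathcal F^0(\mathcal S) = \mathcal S$, $\mathcal F^{i+1}(\mathcal S) = \{ g(v_1,\dots,v_t) : g \in \mathcal F \text{ of arity } t,\ v_1,\dots,v_t \in \mathcal F^{i}(\mathcal S)\}$, and $Cl_{\mathcal F}(\mathcal S) = \bigcup_{i \ge 0} \mathcal F^i(\mathcal S)$. The problem $\textsc{Closure}_{\mathcal F}$ is the following decision problem: given (the size $n$,) a vector $v \in D^n$ and a finite set $\mathcal S \subseteq D^n$, with $\mathcal S$ given as a list of its elements and each vector written out as its sequence of coefficients over the alphabet $D$ with one additional separator symbol, decide whether $v \in Cl_{\mathcal F}(\mathcal S)$. **Proposition.** $\textsc{Closure}_{\langle f\rangle}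 \in \mathsf P$. That is, the language of words encoding pairs $(v, \mathcal S)$ with $v \in Cl_{\langle f\rangle}(\mathcal S)$ is decided by a deterministic Turing machine in a number of steps bounded by a polynomial in the length of the input word; the machine and the polynomial may depend on $D$ and $f$, which are not part of the input. -/

import Mathlib

namespace ClosureProblem

/-- Finitary operations on `D`: an arity `t` together with a function `D ^ t → D`. -/
abbrev Op (D : Type) : Type := Σ t : ℕ, ((Fin t → D) → D)

/-- A binary function, seen as an operation of arity two. -/
def binaryOp {D : Type} (f : D → D → D) : Op D := ⟨2, fun x => f (x 0) (x 1)⟩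

/-- `InClone F n g`: the `n`-ary operation `g` is a composition of operations of `F`
and of projections. -/
inductive InClone {D : Type} (F : Set (Op D)) (n : ℕ) : ((Fin n → D) → D) → Prop
  | proj (k : Fin n) : InClone F n (fun x => x k)
  | comp (f : Op D) (hf : f ∈ F) (g : Fin f.1 → (Fin n → D) → D)
      (hg : ∀ j, InClone F n (g j)) : InClone F n (fun x => f.2 (fun j => g j x))

/-- The functional clone generated by a set of operations. -/
def clone {D : Type} (F : Set (Op D)) : Set (Op D) := {g | InClone F g.1 g.2}

/-- The coefficient-wise action of an operation on vectors of size `n`. -/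
def Op.onVectors {D : Type} (f : Op D) {n : ℕ} (v : Fin f.1 → Fin n → D) : Fin n → D :=
  fun i => f.2 (fun j => v j i)

/-- `stage F S i` is `F ^ i (S)`: `F ^ 0 (S) = S`, and `F ^ (i + 1) (S)` is the set of all
`f (v₁, …, vₜ)` with `f ∈ F` and `v₁, …, vₜ ∈ F ^ i (S)`. -/
def stage {D : Type} (F : Set (Op D)) {n : ℕ} (S : Set (Fin n → D)) : ℕ → Set (Fin n → D)
  | 0 => S
  | i + 1 => {w | ∃ f ∈ F, ∃ v : Fin f.1 → Fin n → D, (∀ j, v j ∈ stage F S i) ∧ w = f.onVectors v}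

/-- The closure `Cl_F (S)` of a set of vectors of size `n`. -/
def Cl {D : Type} (F : Set (Op D)) {n : ℕ} (S : Set (Fin n → D)) : Set (Fin n → D) :=
  ⋃ i, stage F S i

/-- A list of vectors of size `n` as a word over `D` with one extra symbol `none`; each vector is
written as `none` followed by its coefficients. -/
def encodeVectors {D : Type} {n : ℕ} (l : List (Fin n → D)) : List (Option D) :=
  l.flatMap (fun v => none :: (List.ofFn v).map some)

/-- The decision problem `Closure_F`, as a language: the words that encode a vector `v` followed by
a list of the elements of a finite set `S` of vectors of the same size, such that `v ∈ Cl_F (S)`. -/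
def closureProblem {D : Type} (F : Set (Op D)) : Language (Option D) :=
  {w | ∃ (n : ℕ) (v : Fin n → D) (l : List (Fin n → D)),
    w = encodeVectors (v :: l) ∧ v ∈ Cl F {s | s ∈ l}}

/-- The class `P`: languages whose characteristic function is computed, on every input word, by a
multi-stack Turing machine within a number of steps polynomial in the length of the word. -/
def InP {A : Type} (L : Language A) : Prop :=
  ∃ χ : List A → Bool, (∀ w, χ w = true ↔ w ∈ L) ∧
    Nonempty (Turing.TM2ComputableInPolyTime (fun w : List A => w) Computability.encodeBool χ)

/-- `f` is the operation of a commutative group structure on `D`. -/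
def IsCommGroupOp {D : Type} (f : D → D → D) : Prop :=
  (∀ a b c, f (f a b) c = f a (f b c)) ∧ (∀ a b, f a b = f b a) ∧
    ∃ e, (∀ a, f e a = a) ∧ ∀ a, ∃ b, f b a = e

end ClosureProblem

/-!
In a finite group the closure of a nonempty set under addition is the subgroup it generates, so the
problem is to decide membership in a subgroup of `D ^ n` given by generators. This is done by a
Gaussian elimination that works over any finite abelian group. A subgroup `H` of `D × M` is the
graph of a function `P` over its projection `A` to `D`, modulo its intersection `K` with `M`. If `m`
is the order of `c` modulo `A`, a new generator `(c, x)` of `H` enlarges `A` by `c` and `K` by the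
single generator `m • x - P (m • c)`. Hence eliminating one coordinate shortens the vectors without
increasing their number. There are only finitely many groups `A` and columns `D → D` of `P`, so a
machine can keep `A` in its state and `P` on a stack; it eliminates one coordinate in linear time,
and decides membership in quadratic time.
-/

namespace ClosureProblem

section Closure

variable {D : Type} {n : ℕ}

theorem subset_Cl (F : Set (Op D)) (S : Set (Fin n → D)) : S ⊆ Cl F S :=
  fun _ hs => Set.mem_iUnion.2 ⟨0, hs⟩

theorem stage_clone_mono (F : Set (Op D)) (S : Set (Fin n → D)) : Monotone (stage (clone F) S) :=
  monotone_nat_of_le_succ fun _ w hw =>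
    ⟨⟨1, fun x => x 0⟩, .proj (F := F) (0 : Fin 1), fun _ => w, fun _ => hw, rfl⟩

theorem binaryOp_mem_clone (f : D → D → D) : binaryOp f ∈ clone {binaryOp f} :=
  InClone.comp (n := 2) (binaryOp f) (Set.mem_singleton _) (fun j x => x j) .proj

variable [Add D]

theorem add_mem_Cl {S : Set (Fin n → D)} {x y : Fin n → D}
    (hx : x ∈ Cl (clone {binaryOp (· + ·)}) S) (hy : y ∈ Cl (clone {binaryOp (· + ·)}) S) :
    x + y ∈ Cl (clone {binaryOp (· + ·)}) S := by
  obtain ⟨i, hi⟩ := Set.mem_iUnion.1 hx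
  obtain ⟨j, hj⟩ := Set.mem_iUnion.1 hy
  refine Set.mem_iUnion.2 ⟨max i j + 1, _, binaryOp_mem_clone _, ![x, y], ?_, rfl⟩
  exact Fin.forall_fin_two.2 ⟨stage_clone_mono _ S (le_max_left i j) hi,
    stage_clone_mono _ S (le_max_right i j) hj⟩

theorem onVectors_mem_addSubsemigroup (H : AddSubsemigroup (Fin n → D)) {g : Op D}
    (hg : g ∈ clone {binaryOp (· + ·)}) {v : Fin g.1 → Fin n → D} (hv : ∀ j, v j ∈ H) :
    g.onVectors v ∈ H := by
  obtain ⟨t, g⟩ := g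
  change InClone _ t g at hg
  induction hg with
  | proj k => exact hv k
  | comp f hf g hg ih =>
    obtain rfl := Set.mem_singleton_iff.1 hf
    exact H.add_mem (ih (0 : Fin 2) hv) (ih (1 : Fin 2) hv)

theorem Cl_clone_add (S : Set (Fin n → D)) :
    Cl (clone {binaryOp (· + ·)}) S = AddSubsemigroup.closure S := by
  refine Set.Subset.antisymm (Set.iUnion_subset fun i => ?_) fun x hx => ?_
  · induction i with
    | zero => exact AddSubsemigroup.subset_closure
    | succ i ih =>
      rintro _ ⟨g, hg, v, hv, rfl⟩
      exact onVectors_mem_addSubsemigroup _ hg fun j => ih (hv j)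
  · induction hx using AddSubsemigroup.closure_induction with
    | mem x hx => exact subset_Cl _ S hx
    | add x y _ _ hx hy => exact add_mem_Cl hx hy

end Closure

section Group

variable {G : Type*}

theorem mem_addSubmonoid_closure_iff [AddMonoid G] {S : Set G} {x : G} :
    x ∈ AddSubmonoid.closure S ↔ x = 0 ∨ x ∈ AddSubsemigroup.closure S := by
  constructor
  · intro hx
    induction hx using AddSubmonoid.closure_induction with
    | mem x hx => exact .inr (AddSubsemigroup.subset_closure hx)
    | zero => exact .inl rfl
    | add x y _ _ hx hy =>
      obtain rfl | hx := hx
      · rwa [zero_add]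
      · obtain rfl | hy := hy
        exacts [.inr (by rwa [add_zero]), .inr (add_mem hx hy)]
  · rintro (rfl | hx)
    · exact zero_mem _
    · exact (AddSubsemigroup.closure_le (S := (AddSubmonoid.closure S).toAddSubsemigroup)).2
        AddSubmonoid.subset_closure hx

theorem mem_addSubsemigroup_closure_iff [AddGroup G] [Finite G] {S : Set G} {x : G} :
    x ∈ AddSubsemigroup.closure S ↔ S.Nonempty ∧ x ∈ AddSubgroup.closure S := by
  rw [← AddSubgroup.mem_toAddSubmonoid, AddSubgroup.closure_toAddSubmonoid_of_finite,
    mem_addSubmonoid_closure_iff]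
  constructor
  · intro hx
    refine ⟨Set.nonempty_iff_ne_empty.2 ?_, .inr hx⟩
    rintro rfl
    rwa [AddSubsemigroup.closure_empty] at hx
  · rintro ⟨⟨s, hs⟩, rfl | hx⟩
    · have hs' := AddSubsemigroup.subset_closure hs
      have hneg : -s ∈ AddSubmonoid.closure S := by
        rw [← AddSubgroup.closure_toAddSubmonoid_of_finite]
        exact (AddSubgroup.closure S).neg_mem (AddSubgroup.subset_closure hs)
      obtain h | h := mem_addSubmonoid_closure_iff.1 hneg
      · rwa [neg_eq_zero.1 h] at hs'
      · simpa using add_mem hs' h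
    · exact hx

theorem mem_sup_zmultiples_iff [AddCommGroup G] {A : AddSubgroup G} {c d : G} :
    d ∈ A ⊔ AddSubgroup.zmultiples c ↔ ∃ z : ℤ, d - z • c ∈ A := by
  simp only [AddSubgroup.mem_sup, AddSubgroup.exists_mem_zmultiples]
  constructor
  · rintro ⟨a, ha, z, rfl⟩
    exact ⟨z, by rwa [add_sub_cancel_right]⟩
  · rintro ⟨z, hz⟩
    exact ⟨_, hz, z, sub_add_cancel _ _⟩

theorem closure_image_cons {α : Type*} [AddCommGroup G] (φ : α → G) (g : α) (gens : List α) :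
    AddSubgroup.closure (φ '' {v | v ∈ g :: gens}) =
      AddSubgroup.zmultiples (φ g) ⊔ AddSubgroup.closure (φ '' {v | v ∈ gens}) := by
  simp only [List.mem_cons, Set.ofPred_or, Set.ofPred_eq_eq_singleton, Set.image_union,
    Set.image_singleton, AddSubgroup.closure_union, AddSubgroup.zmultiples_eq_closure]

end Group

section Elimination

variable {D M : Type*} [AddCommGroup D]

/-- The order of `c` modulo `A`. -/
noncomputable def relOrder (A : AddSubgroup D) (c : D) : ℕ := addOrderOf (c : D ⧸ A)

theorem zsmul_mem_iff_relOrder_dvd {A : AddSubgroup D} {c : D} {z : ℤ} :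
    z • c ∈ A ↔ (relOrder A c : ℤ) ∣ z := by
  rw [relOrder, addOrderOf_dvd_iff_zsmul_eq_zero, ← QuotientAddGroup.mk_zsmul,
    QuotientAddGroup.eq_zero_iff]

theorem relOrder_nsmul_mem (A : AddSubgroup D) (c : D) : relOrder A c • c ∈ A := by
  rw [← natCast_zsmul, zsmul_mem_iff_relOrder_dvd]

theorem relOrder_eq_one_iff {A : AddSubgroup D} {c : D} : relOrder A c = 1 ↔ c ∈ A := by
  rw [relOrder, AddMonoid.addOrderOf_eq_one_iff, QuotientAddGroup.eq_zero_iff]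

open Classical in
/-- A coefficient `z` with `d - z • c ∈ A`, which is how elements of `A ⊔ ⟨c⟩` are reduced to `A`;
it is `0` when `d ∉ A ⊔ ⟨c⟩`. -/
noncomputable def relCoeff (A : AddSubgroup D) (c d : D) : ℤ :=
  if h : ∃ z : ℤ, d - z • c ∈ A then h.choose else 0

theorem sub_relCoeff_zsmul_mem {A : AddSubgroup D} {c d : D} (h : ∃ z : ℤ, d - z • c ∈ A) :
    d - relCoeff A c d • c ∈ A := by
  rw [relCoeff, dif_pos h]
  exact h.choose_spec

theorem exists_eq_relCoeff_add {A : AddSubgroup D} {c d : D} {z : ℤ} (h : d - z • c ∈ A) :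
    ∃ q : ℤ, z = relCoeff A c d + relOrder A c * q := by
  have hdvd : (relOrder A c : ℤ) ∣ z - relCoeff A c d := by
    rw [← zsmul_mem_iff_relOrder_dvd]
    convert A.sub_mem (sub_relCoeff_zsmul_mem ⟨z, h⟩) h using 1
    rw [sub_sub_sub_cancel_left, sub_zsmul, ← sub_eq_add_neg]
  obtain ⟨q, hq⟩ := hdvd
  exact ⟨q, eq_add_of_sub_eq' hq⟩

variable [AddCommGroup M]

/-- `H` is the graph of the function `P` over `A`, modulo `K`. A subgroup `H` of a product is
stored in this form, `A` being its projection and `K` its intersection with the second factor. -/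
def IsGraphMod (H : AddSubgroup (D × M)) (A : AddSubgroup D) (P : D → M) (K : AddSubgroup M) :
    Prop :=
  ∀ d y, (d, y) ∈ H ↔ d ∈ A ∧ y - P d ∈ K

/-- The element which a new generator `(c, x)` of `H` contributes to the generators of `K`. -/
noncomputable def kernelVector (A : AddSubgroup D) (P : D → M) (c : D) (x : M) : M :=
  relOrder A c • x - P (relOrder A c • c)

/-- The function over `A ⊔ ⟨c⟩` which replaces `P` after the new generator `(c, x)` of `H`. -/
noncomputable def extendSection (A : AddSubgroup D) (P : D → M) (c : D) (x : M) (d : D) : M :=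
  P (d - relCoeff A c d • c) + relCoeff A c d • x

theorem isGraphMod_bot : IsGraphMod (⊥ : AddSubgroup (D × M)) ⊥ 0 ⊥ := by
  intro d y
  simp [Prod.ext_iff]

namespace IsGraphMod

variable {H : AddSubgroup (D × M)} {A : AddSubgroup D} {P : D → M} {K : AddSubgroup M}

theorem apply_mem (h : IsGraphMod H A P K) {a : D} (ha : a ∈ A) : (a, P a) ∈ H :=
  (h _ _).2 ⟨ha, by simp⟩

theorem zero_mem_iff (h : IsGraphMod H A P K) {y : M} : (0, y) ∈ H ↔ y ∈ K := by
  have h0 : -P 0 ∈ K := by simpa using ((h 0 0).1 H.zero_mem).2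
  rw [h, sub_eq_add_neg, K.add_mem_cancel_right h0, and_iff_right A.zero_mem]

theorem sub_zsmul_mem_iff (h : IsGraphMod H A P K) {c d : D} {x y : M} {q : ℤ}
    (hd : ∃ z : ℤ, d - z • c ∈ A) :
    (d, y) - (relCoeff A c d + relOrder A c * q) • (c, x) ∈ H ↔
      y - extendSection A P c x d - q • kernelVector A P c x ∈ K := by
  have correction_mem := H.sub_mem (H.zsmul_mem (h.apply_mem (relOrder_nsmul_mem A c)) q)
    (h.apply_mem (sub_relCoeff_zsmul_mem hd))
  rw [← h.zero_mem_iff, ← H.add_mem_cancel_right correction_mem]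
  refine iff_of_eq (congrArg (· ∈ H) (Prod.ext ?_ ?_))
  · simp only [Prod.fst_add, Prod.fst_sub, Prod.smul_fst, add_zsmul, mul_comm _ q, mul_zsmul,
      natCast_zsmul]
    abel
  · simp only [Prod.snd_add, Prod.snd_sub, Prod.smul_snd, add_zsmul, mul_comm _ q, mul_zsmul,
      natCast_zsmul, extendSection, kernelVector, zsmul_sub]
    abel

theorem extend (h : IsGraphMod H A P K) (c : D) (x : M) :
    IsGraphMod (H ⊔ AddSubgroup.zmultiples (c, x)) (A ⊔ AddSubgroup.zmultiples c)
      (extendSection A P c x) (K ⊔ AddSubgroup.zmultiples (kernelVector A P c x)) := by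
  intro d y
  simp only [mem_sup_zmultiples_iff]
  constructor
  · rintro ⟨z, hz⟩
    have hd : d - z • c ∈ A := ((h _ _).1 hz).1
    obtain ⟨q, rfl⟩ := exists_eq_relCoeff_add hd
    exact ⟨⟨_, hd⟩, q, (h.sub_zsmul_mem_iff ⟨_, hd⟩).1 hz⟩
  · rintro ⟨hd, q, hq⟩
    exact ⟨_, (h.sub_zsmul_mem_iff hd).2 hq⟩

/-- For `c ∈ A` the contribution of `(c, x)` is its reduction modulo the graph. -/
theorem mem_iff_kernelVector_mem (h : IsGraphMod H A P K) {c : D} {x : M} :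
    (c, x) ∈ H ↔ c ∈ A ∧ kernelVector A P c x ∈ K := by
  rw [h]
  refine and_congr_right fun hc => ?_
  rw [kernelVector, relOrder_eq_one_iff.2 hc, one_nsmul, one_nsmul]

end IsGraphMod

end Elimination

section Lists

variable {D : Type*}

/-- A list as a sequence that is eventually zero. Lists of different lengths become elements of one
group in this way. -/
def toSeq {α : Type*} [Zero α] (l : List α) (i : ℕ) : α := l.getD i 0

section ToSeq

variable {α : Type*} [Zero α]

@[simp]
theorem toSeq_nil : toSeq ([] : List α) = 0 := by
  funext i
  simp [toSeq]

theorem toSeq_zero (l : List α) : toSeq l 0 = l.headD 0 := by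
  cases l <;> rfl

theorem toSeq_succ (l : List α) (i : ℕ) : toSeq l (i + 1) = toSeq l.tail i := by
  cases l <;> simp [toSeq]

end ToSeq

variable [AddCommGroup D]

/-- The row that stores `kernelVector`, for a table of columns that stores the function `P`. -/
noncomputable def kernelRow (A : AddSubgroup D) (c : D) : List D → List (D → D) → List D
  | [], _ => []
  | x :: xs, T => kernelVector A (T.headD 0) c x :: kernelRow A c xs T.tail

/-- The table of columns that stores `extendSection`. -/
noncomputable def extendTable (A : AddSubgroup D) (c : D) : List D → List (D → D) → List (D → D)
  | [], T => T
  | x :: xs, T => extendSection A (T.headD 0) c x :: extendTable A c xs T.tail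

@[simp]
theorem length_kernelRow (A : AddSubgroup D) (c : D) (x : List D) (T : List (D → D)) :
    (kernelRow A c x T).length = x.length := by
  induction x generalizing T with
  | nil => rfl
  | cons a x ih => simp [kernelRow, ih]

@[simp]
theorem length_extendTable (A : AddSubgroup D) (c : D) (x : List D) (T : List (D → D)) :
    (extendTable A c x T).length = max x.length T.length := by
  induction x generalizing T with
  | nil => simp [extendTable]
  | cons a x ih =>
    simp only [extendTable, List.length_cons, ih, List.length_tail]
    omega

theorem toSeq_kernelRow (A : AddSubgroup D) (c : D) {x : List D} {T : List (D → D)}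
    (h : T.length ≤ x.length) :
    toSeq (kernelRow A c x T) = kernelVector A (Function.swap (toSeq T)) c (toSeq x) := by
  induction x generalizing T with
  | nil =>
    obtain rfl := List.length_eq_zero_iff.1 (Nat.le_zero.1 h)
    funext i
    simp [kernelRow, kernelVector, Function.swap]
  | cons a x ih =>
    funext i
    cases i with
    | zero => simp [kernelRow, kernelVector, toSeq_zero, Function.swap]
    | succ i =>
      have := congrFun (ih (T := T.tail) (by simpa using h)) i
      simpa [kernelRow, kernelVector, toSeq_succ, Function.swap] using this

theorem toSeq_extendTable (A : AddSubgroup D) (c : D) {x : List D} {T : List (D → D)}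
    (h : T.length ≤ x.length) :
    Function.swap (toSeq (extendTable A c x T)) =
      extendSection A (Function.swap (toSeq T)) c (toSeq x) := by
  induction x generalizing T with
  | nil =>
    obtain rfl := List.length_eq_zero_iff.1 (Nat.le_zero.1 h)
    funext d i
    simp [extendTable, extendSection, Function.swap]
  | cons a x ih =>
    funext d i
    cases i with
    | zero => simp [extendTable, extendSection, toSeq_zero, Function.swap]
    | succ i =>
      have := congrFun₂ (ih (T := T.tail) (by simpa using h)) d i
      simpa [extendTable, extendSection, toSeq_succ, Function.swap] using this

end Lists

section Sweep

variable {D : Type*}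

/-- The kind of a list of rows, which is what the machine remembers about the rows it has passed.
A row is proper if it is not empty; for proper rows, `lastMem` says whether the first coefficient
of the last row lies in the group generated by those of the preceding rows. -/
inductive Status
  | noRows
  | oneEmptyRow
  | emptyRows
  | properRows (lastMem : Bool)
  | mixedRows
  deriving DecidableEq

namespace Status

instance : Fintype Status :=
  ⟨{noRows, oneEmptyRow, emptyRows, properRows false, properRows true, mixedRows},
    fun s => by rcases s with _ | _ | _ | (_ | _) | _ <;> decide⟩

/-- The kind of a list of rows after appending an empty row. -/
def addEmpty : Status → Status
  | noRows => oneEmptyRow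
  | oneEmptyRow | emptyRows => emptyRows
  | properRows _ | mixedRows => mixedRows

/-- The kind of a list of rows after appending a proper row. -/
def addProper : Status → Bool → Status
  | noRows, b | properRows _, b => properRows b
  | oneEmptyRow, _ | emptyRows, _ | mixedRows, _ => mixedRows

/-- The answer for a list of rows of the given kind, or `none` if another sweep is needed. -/
def verdict : Status → Option Bool
  | noRows | oneEmptyRow | mixedRows => some false
  | emptyRows => some true
  | properRows lastMem => if lastMem then none else some false

theorem verdict_eq_none_iff {s : Status} : s.verdict = none ↔ s = properRows true := by
  cases s <;> simp [verdict]

/-- A list of rows is of the given kind, apart from the meaning of `lastMem`. -/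
def Fits (vs : List (List D)) : Status → Prop
  | noRows => vs = []
  | oneEmptyRow => vs = [[]]
  | emptyRows => 2 ≤ vs.length ∧ ∀ v ∈ vs, v = []
  | properRows _ => vs ≠ [] ∧ ∀ v ∈ vs, v ≠ []
  | mixedRows => [] ∈ vs ∧ ∃ v ∈ vs, v ≠ []

theorem Fits.addEmpty {vs : List (List D)} {s : Status} (h : s.Fits vs) :
    s.addEmpty.Fits (vs ++ [[]]) := by
  cases s with
  | noRows => obtain rfl := h; rfl
  | oneEmptyRow => obtain rfl := h; exact ⟨le_rfl, by simp⟩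
  | emptyRows => exact ⟨h.1.trans (by simp), List.forall_mem_append.2 ⟨h.2, by simp⟩⟩
  | properRows _ =>
    obtain ⟨v, hv⟩ := List.exists_mem_of_ne_nil vs h.1
    exact ⟨by simp, v, List.mem_append_left _ hv, h.2 v hv⟩
  | mixedRows =>
    obtain ⟨-, v, hv, hne⟩ := h
    exact ⟨by simp, v, List.mem_append_left _ hv, hne⟩

theorem Fits.addProper {vs : List (List D)} {s : Status} (h : s.Fits vs) (b : Bool) (c : D)
    (x : List D) : (s.addProper b).Fits (vs ++ [c :: x]) := by
  have mixed (hvs : [] ∈ vs) : mixedRows.Fits (vs ++ [c :: x]) :=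
    ⟨List.mem_append_left _ hvs, c :: x, by simp, by simp⟩
  cases s with
  | noRows => obtain rfl := h; exact ⟨by simp, by simp⟩
  | oneEmptyRow => obtain rfl := h; exact mixed (by simp)
  | emptyRows =>
    obtain ⟨v, hv⟩ := List.exists_mem_of_length_pos (zero_lt_two.trans_le h.1)
    exact mixed (h.2 v hv ▸ hv)
  | properRows _ => exact ⟨by simp, List.forall_mem_append.2 ⟨h.2, by simp⟩⟩
  | mixedRows => exact mixed h.1

theorem eq_of_addProper_eq_properRows {s : Status} {b b' : Bool}
    (h : s.addProper b = properRows b') : b = b' := by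
  cases s <;> simp_all [addProper]

end Status

variable [AddCommGroup D]

/-- A sequence as the pair of its first term and the sequence of the others. -/
def splitHead : (ℕ → D) →+ D × (ℕ → D) where
  toFun w := (w 0, fun i => w (i + 1))
  map_zero' := rfl
  map_add' _ _ := rfl

theorem splitHead_injective : Function.Injective (splitHead (D := D)) := by
  intro v w h
  funext i
  cases i with
  | zero => exact congrArg Prod.fst h
  | succ i => exact congrFun (congrArg Prod.snd h) i

theorem splitHead_toSeq_cons (c : D) (x : List D) : splitHead (toSeq (c :: x)) = (c, toSeq x) :=
  rfl

/-- The state of a sweep, in which the first coordinates of a list of rows are eliminated. The group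
generated by the rows passed so far is stored in the form of `IsGraphMod`, where `group` is `A` and
`table` lists the columns of `P`; the generators of `K` are the output of the sweep. -/
structure SweepState (D : Type*) [AddCommGroup D] where
  group : AddSubgroup D
  table : List (D → D)
  status : Status

namespace SweepState

/-- The state before any row. -/
def start : SweepState D := ⟨⊥, [], .noRows⟩

open Classical in
/-- The state after one more row. -/
noncomputable def next (st : SweepState D) : List D → SweepState D
  | [] => { st with status := st.status.addEmpty }
  | c :: x =>
    ⟨st.group ⊔ AddSubgroup.zmultiples c, extendTable st.group c x st.table,
      st.status.addProper (decide (c ∈ st.group))⟩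

/-- What is left of one more row after the elimination of its first coordinate. -/
noncomputable def reduce (st : SweepState D) : List D → List D
  | [] => []
  | c :: x => kernelRow st.group c x st.table

/-- What is left of a list of rows after the elimination of the first coordinates. -/
noncomputable def sweep : SweepState D → List (List D) → List (List D)
  | _, [] => []
  | st, v :: vs => st.reduce v :: sweep (st.next v) vs

theorem sweep_append (st : SweepState D) (vs ws : List (List D)) :
    st.sweep (vs ++ ws) = st.sweep vs ++ (vs.foldl next st).sweep ws := by
  induction vs generalizing st with
  | nil => rfl
  | cons v vs ih => simp [sweep, ih]

theorem length_reduce (st : SweepState D) (v : List D) : (st.reduce v).length = v.length - 1 := by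
  cases v with
  | nil => rfl
  | cons c x => exact length_kernelRow _ _ _ _

theorem forall_mem_sweep_length_iff {p : ℕ → Prop} (st : SweepState D) (vs : List (List D)) :
    (∀ w ∈ st.sweep vs, p w.length) ↔ ∀ v ∈ vs, p (v.length - 1) := by
  induction vs generalizing st with
  | nil => simp [sweep]
  | cons v vs ih => simp [sweep, ih, length_reduce]

@[simp]
theorem sweep_eq_nil_iff {st : SweepState D} {vs : List (List D)} : st.sweep vs = [] ↔ vs = [] := by
  cases vs <;> simp [sweep]

theorem length_table_next_le {st : SweepState D} {v : List D} {n : ℕ} (hst : st.table.length ≤ n)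
    (hv : v.length ≤ n + 1) : (st.next v).table.length ≤ n := by
  cases v with
  | nil => exact hst
  | cons c x => simpa [next] using ⟨by simpa using hv, hst⟩

theorem length_table_foldl_le {st : SweepState D} {vs : List (List D)} {n : ℕ}
    (hst : st.table.length ≤ n) (hvs : ∀ v ∈ vs, v.length ≤ n + 1) :
    (vs.foldl next st).table.length ≤ n := by
  induction vs generalizing st with
  | nil => exact hst
  | cons v vs ih =>
    obtain ⟨hv, hvs⟩ := List.forall_mem_cons.1 hvs
    exact ih (length_table_next_le hst hv) hvs

theorem fits_foldl_next (vs : List (List D)) : (vs.foldl next start).status.Fits vs := by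
  induction vs using List.reverseRecOn with
  | nil => rfl
  | append_singleton vs v ih =>
    rw [List.foldl_append]
    cases v with
    | nil => exact ih.addEmpty
    | cons c x => exact ih.addProper _ c x

theorem isGraphMod_foldl {st : SweepState D} {H : AddSubgroup (D × (ℕ → D))}
    {K : AddSubgroup (ℕ → D)} (h : IsGraphMod H st.group (Function.swap (toSeq st.table)) K)
    {gens : List (List D)} {n : ℕ} (hst : st.table.length ≤ n)
    (hgens : ∀ g ∈ gens, g.length = n + 1) :
    IsGraphMod (H ⊔ AddSubgroup.closure ((splitHead ∘ toSeq) '' {g | g ∈ gens}))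
      (gens.foldl next st).group (Function.swap (toSeq (gens.foldl next st).table))
      (K ⊔ AddSubgroup.closure (toSeq '' {g | g ∈ st.sweep gens})) := by
  induction gens generalizing st H K with
  | nil => simpa [sweep] using h
  | cons g gens ih =>
    obtain ⟨hg, hgens'⟩ := List.forall_mem_cons.1 hgens
    obtain ⟨c, x, rfl⟩ := List.exists_cons_of_length_eq_add_one hg
    have hx : st.table.length ≤ x.length := by simpa [Nat.succ_inj.1 hg] using hst
    have hnext := h.extend c (toSeq x)
    rw [← toSeq_kernelRow _ _ hx, ← toSeq_extendTable _ _ hx] at hnext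
    simpa only [sweep, reduce, List.foldl_cons, closure_image_cons, Function.comp_apply,
      splitHead_toSeq_cons, sup_assoc] using
      ih (st := st.next (c :: x)) hnext (length_table_next_le hst hg.le) hgens'

end SweepState

open SweepState

/-- The last row is in the group generated by the other rows, of which there is at least one, and
all rows have the same length. -/
def Solvable (vs : List (List D)) : Prop :=
  ∃ gens t, vs = gens ++ [t] ∧ gens ≠ [] ∧ (∀ g ∈ gens, g.length = t.length) ∧
    toSeq t ∈ AddSubgroup.closure (toSeq '' {g | g ∈ gens})

theorem solvable_append_singleton {gens : List (List D)} {t : List D} :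
    Solvable (gens ++ [t]) ↔ gens ≠ [] ∧ (∀ g ∈ gens, g.length = t.length) ∧
      toSeq t ∈ AddSubgroup.closure (toSeq '' {g | g ∈ gens}) := by
  constructor
  · rintro ⟨gens', t', h, h'⟩
    obtain ⟨rfl, rfl⟩ := List.concat_inj.1 (by simpa using h)
    exact h'
  · exact fun h => ⟨gens, t, rfl, h⟩

theorem toSeq_mem_closure_iff {gens : List (List D)} {t : List D} :
    toSeq t ∈ AddSubgroup.closure (toSeq '' {g | g ∈ gens}) ↔
      splitHead (toSeq t) ∈
        AddSubgroup.closure ((splitHead ∘ toSeq) '' {g | g ∈ gens}) := by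
  rw [Set.image_comp, ← AddMonoidHom.map_closure,
    AddSubgroup.mem_map_iff_mem splitHead_injective]

theorem toSeq_cons_mem_closure_iff {gens : List (List D)} {c : D} {x : List D}
    (hgens : ∀ g ∈ gens, g.length = x.length + 1) :
    toSeq (c :: x) ∈ AddSubgroup.closure (toSeq '' {g | g ∈ gens}) ↔
      c ∈ (gens.foldl next start).group ∧ toSeq ((gens.foldl next start).reduce (c :: x)) ∈
        AddSubgroup.closure (toSeq '' {g | g ∈ start.sweep gens}) := by
  have hx : (gens.foldl next start).table.length ≤ x.length :=
    length_table_foldl_le (Nat.zero_le _) fun g hg => (hgens g hg).le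
  have hstart : IsGraphMod ⊥ start.group (Function.swap (toSeq (start : SweepState D).table)) ⊥ :=
    isGraphMod_bot
  have hgraph := isGraphMod_foldl hstart (Nat.zero_le _) hgens
  rw [bot_sup_eq, bot_sup_eq] at hgraph
  rw [toSeq_mem_closure_iff, splitHead_toSeq_cons, hgraph.mem_iff_kernelVector_mem, reduce,
    toSeq_kernelRow _ _ hx]

theorem solvable_iff_solvable_sweep {gens : List (List D)} {c : D} {x : List D}
    (hgens : ∀ g ∈ gens, g ≠ []) :
    Solvable (gens ++ [c :: x]) ↔
      c ∈ (gens.foldl next start).group ∧ Solvable (start.sweep (gens ++ [c :: x])) := by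
  have hlen : (∀ g ∈ gens, g.length - 1 = x.length) ↔ ∀ g ∈ gens, g.length = x.length + 1 :=
    forall₂_congr fun g hg => by have := List.length_pos_iff.2 (hgens g hg); omega
  rw [sweep_append, sweep, sweep, solvable_append_singleton, solvable_append_singleton]
  simp only [ne_eq, sweep_eq_nil_iff, length_reduce, List.length_cons, Nat.add_one_sub_one,
    forall_mem_sweep_length_iff (p := (· = x.length)), hlen]
  have := toSeq_cons_mem_closure_iff (gens := gens) (c := c) (x := x)
  tauto

theorem solvable_of_emptyRows {vs : List (List D)} (h : Status.emptyRows.Fits vs) :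
    Solvable vs := by
  obtain ⟨hlen, hvs⟩ := h
  obtain rfl | ⟨gens, t, rfl⟩ := vs.eq_nil_or_concat'
  · cases hlen
  · obtain ⟨hgens, ht⟩ := List.forall_mem_append.1 hvs
    obtain rfl := ht t (by simp)
    refine solvable_append_singleton.2 ⟨?_, fun g hg => by rw [hgens g hg], by simp⟩
    rintro rfl
    simp at hlen

theorem Solvable.length_eq {vs : List (List D)} (h : Solvable vs) {v w : List D} (hv : v ∈ vs)
    (hw : w ∈ vs) : v.length = w.length := by
  obtain ⟨gens, t, rfl, -, hlen, -⟩ := h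
  have hlen' : ∀ u ∈ gens ++ [t], u.length = t.length :=
    List.forall_mem_append.2 ⟨hlen, by simp⟩
  rw [hlen' v hv, hlen' w hw]

theorem not_solvable_of_mixedRows {vs : List (List D)} (h : Status.mixedRows.Fits vs) :
    ¬Solvable vs := by
  obtain ⟨hnil, v, hv, hne⟩ := h
  exact fun hvs => hne (List.length_eq_zero_iff.1 (hvs.length_eq hv hnil))

theorem not_solvable_of_length_le_one {vs : List (List D)} (h : vs.length ≤ 1) :
    ¬Solvable vs := by
  rintro ⟨gens, t, rfl, hgens, -⟩
  have := List.length_pos_iff.2 hgens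
  simp only [List.length_append, List.length_singleton] at h
  omega

theorem solvable_iff_of_properRows {vs : List (List D)} {b : Bool}
    (h : (vs.foldl next start).status = .properRows b) :
    Solvable vs ↔ b = true ∧ Solvable (start.sweep vs) := by
  have hfits := fits_foldl_next vs
  rw [h] at hfits
  obtain rfl | ⟨gens, _ | ⟨c, x⟩, rfl⟩ := vs.eq_nil_or_concat'
  · exact absurd rfl hfits.1
  · exact absurd rfl (hfits.2 [] (by simp))
  · rw [List.foldl_append] at h
    rw [solvable_iff_solvable_sweep (List.forall_mem_append.1 hfits.2).1,
      ← Status.eq_of_addProper_eq_properRows h]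
    simp only [decide_eq_true_iff]

theorem solvable_iff_of_verdict_eq_some {vs : List (List D)} {b : Bool}
    (h : (vs.foldl next start).status.verdict = some b) : Solvable vs ↔ b = true := by
  have hfits := fits_foldl_next vs
  cases hst : (vs.foldl next start).status with rw [hst] at h hfits
  | properRows lastMem =>
    cases lastMem with
    | false =>
      obtain rfl := Option.some.inj h
      simp [solvable_iff_of_properRows hst]
    | true => cases h
  | noRows =>
    obtain rfl := Option.some.inj h
    simpa using not_solvable_of_length_le_one (vs := vs) (by rw [show vs = [] from hfits]; simp)
  | oneEmptyRow =>
    obtain rfl := Option.some.inj h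
    simpa using not_solvable_of_length_le_one (vs := vs) (by rw [show vs = [[]] from hfits]; simp)
  | emptyRows =>
    obtain rfl := Option.some.inj h
    simpa using solvable_of_emptyRows hfits
  | mixedRows =>
    obtain rfl := Option.some.inj h
    simpa using not_solvable_of_mixedRows hfits

end Sweep

section Machine

open Turing SweepState

/-- The stacks of the machine. The input is on `inp`, which also collects the output of a sweep;
`work` holds the rows still to be swept, `tab` holds `SweepState.table`, and `aux` holds the columns
of the table that the current row has already passed. -/
inductive Stack
  | inp
  | work
  | tab
  | aux
  | out
  deriving DecidableEq

instance : Fintype Stack :=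
  ⟨{.inp, .work, .tab, .aux, .out}, fun k => by cases k <;> decide⟩

/-- The alphabets of the stacks. -/
abbrev Symbol (D : Type) : Stack → Type
  | .inp | .work => Option D
  | .tab | .aux => D → D
  | .out => Bool

section Contents

variable {D : Type}

/-- The contents of the stacks `inp`, `work`, `tab`, `aux`, `out`, in this order. -/
def contents (i w : List (Option D)) (t a : List (D → D)) (o : List Bool := []) :
    ∀ k, List (Symbol D k)
  | .inp => i
  | .work => w
  | .tab => t
  | .aux => a
  | .out => o

variable (i w : List (Option D)) (t a : List (D → D)) (o : List Bool)

@[simp] theorem contents_inp : contents i w t a o .inp = i := rfl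
@[simp] theorem contents_work : contents i w t a o .work = w := rfl
@[simp] theorem contents_tab : contents i w t a o .tab = t := rfl
@[simp] theorem contents_aux : contents i w t a o .aux = a := rfl
@[simp] theorem contents_out : contents i w t a o .out = o := rfl

@[simp]
theorem update_contents_inp (l : List (Option D)) :
    Function.update (contents i w t a o) .inp l = contents l w t a o := by
  funext k; cases k <;> rfl

@[simp]
theorem update_contents_work (l : List (Option D)) :
    Function.update (contents i w t a o) .work l = contents i l t a o := by
  funext k; cases k <;> rfl

@[simp]
theorem update_contents_tab (l : List (D → D)) :
    Function.update (contents i w t a o) .tab l = contents i w l a o := by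
  funext k; cases k <;> rfl

@[simp]
theorem update_contents_aux (l : List (D → D)) :
    Function.update (contents i w t a o) .aux l = contents i w t l o := by
  funext k; cases k <;> rfl

@[simp]
theorem update_contents_out (l : List Bool) :
    Function.update (contents i w t a o) .out l = contents i w t a l := by
  funext k; cases k <;> rfl

end Contents

/-- The registers of the machine: the last symbol popped from a stack of symbols, the last column
popped from a stack of columns, and a bit. -/
structure Reg (D : Type) where
  sym : Option (Option D) := none
  col : Option (D → D) := none
  bit : Bool := false

instance {D : Type} [Finite D] : Finite (Reg D) :=
  Finite.of_injective (fun r : Reg D => (r.sym, r.col, r.bit)) fun ⟨_, _, _⟩ ⟨_, _, _⟩ h => by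
    simpa using h

variable {D : Type} [AddCommGroup D]

/-- The labels of the program. They carry the part of the `SweepState` that is not on a stack. -/
inductive Label (D : Type) [AddCommGroup D]
  | reverse
  | row (A : AddSubgroup D) (s : Status)
  | coeffs (A : AddSubgroup D) (c : D) (s : Status)
  | restoreTable (A : AddSubgroup D) (s : Status)
  | clearTable
  | answer (b : Bool)

instance [Finite D] : Finite (Label D) := by
  refine Finite.of_surjective (α := Unit ⊕ (AddSubgroup D × Status) ⊕ (AddSubgroup D × D × Status) ⊕
    (AddSubgroup D × Status) ⊕ Unit ⊕ Bool)
    (Sum.elim (fun _ => .reverse) <| Sum.elim (fun p => .row p.1 p.2) <|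
      Sum.elim (fun p => .coeffs p.1 p.2.1 p.2.2) <| Sum.elim (fun p => .restoreTable p.1 p.2) <|
      Sum.elim (fun _ => .clearTable) .answer) ?_
  intro l
  cases l <;> simp

open Classical TM2.Stmt in
/-- The program of the machine: it moves the input to `work`, sweeps the rows with one transition of
`SweepState` per row, and starts again with the output of the sweep until the status of a sweep has
a verdict. It empties its stacks before it answers, as the halting configurations of a `FinTM2`
require. -/
noncomputable def program : Label D → TM2.Stmt (Symbol D) (Label D) (Reg D)
  | .reverse =>
    pop .inp (fun s x => { s with sym := x }) <|
    branch (fun s => s.sym.isSome)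
      (push .work (fun s => s.sym.getD none) <| goto fun _ => .reverse)
      (goto fun _ => .row ⊥ .noRows)
  | .row A st =>
    pop .work (fun s x => { s with sym := x }) <|
    branch (fun s => decide (s.sym = some none))
      (push .inp (fun _ => none) <| goto fun _ => .row A st.addEmpty)
      (goto fun s => match s.sym with
        | some (some c) => .coeffs A c st
        | _ => st.verdict.elim .clearTable .answer)
  | .coeffs A c st =>
    pop .work (fun s x => { s with sym := x }) <|
    branch (fun s => s.sym.isSome)
      (branch (fun s => (s.sym.getD none).isSome)
        (pop .tab (fun s t => { s with col := t }) <|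
          push .inp (fun s => (s.sym.getD none).map (kernelVector A (s.col.getD 0) c)) <|
          push .aux (fun s => extendSection A (s.col.getD 0) c ((s.sym.getD none).getD 0)) <|
          goto fun _ => .coeffs A c st)
        (push .inp (fun _ => none) <|
          goto fun _ =>
            .restoreTable (A ⊔ AddSubgroup.zmultiples c) (st.addProper (decide (c ∈ A)))))
      (goto fun _ => .answer false)
  | .restoreTable A st =>
    pop .aux (fun s t => { s with col := t }) <|
    branch (fun s => s.col.isSome)
      (push .tab (fun s => s.col.getD 0) <| goto fun _ => .restoreTable A st)
      (goto fun _ => .row A st)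
  | .clearTable =>
    pop .tab (fun s t => { s with col := t }) <|
    branch (fun s => s.col.isSome) (goto fun _ => .clearTable) (goto fun _ => .reverse)
  | .answer b =>
    pop .inp (fun s x => { s with bit := x.isSome }) <|
    pop .work (fun s x => { s with bit := s.bit || x.isSome }) <|
    pop .tab (fun s x => { s with bit := s.bit || x.isSome }) <|
    pop .aux (fun s x => { s with bit := s.bit || x.isSome }) <|
    branch (fun s => s.bit) (goto fun _ => .answer b)
      (load (fun _ => {}) <| push .out (fun _ => b) halt)

/-- From the label `l` and the stacks `S`, the program answers `b` in at most `k` steps, whatever is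
in the registers. -/
def HaltsWithin (k : ℕ) (l : Label D) (S : ∀ k, List (Symbol D k)) (b : Bool) : Prop :=
  ∀ s, Nonempty (StateTransition.EvalsToInTime (TM2.step program) ⟨some l, s, S⟩
    (some ⟨none, {}, contents [] [] [] [] [b]⟩) k)

section HaltsWithin

variable {k k' : ℕ} {l l' : Label D} {S S' : ∀ k, List (Symbol D k)} {b : Bool}

theorem HaltsWithin.mono (h : HaltsWithin k l S b) (hk : k ≤ k') : HaltsWithin k' l S b :=
  fun s => (h s).map fun e => ⟨e.toEvalsTo, e.steps_le_m.trans hk⟩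

theorem HaltsWithin.of_step (h' : HaltsWithin k l' S' b)
    (h : ∀ s, ∃ s', TM2.stepAux (program l) s S = ⟨some l', s', S'⟩) :
    HaltsWithin (k + 1) l S b := by
  intro s
  obtain ⟨s', hs'⟩ := h s
  exact (h' s').map fun e => .trans _ 1 k _ _ _ ⟨⟨1, congrArg some hs'⟩, le_rfl⟩ e

end HaltsWithin

variable {k : ℕ} {b : Bool}

theorem haltsWithin_reverse {i w : List (Option D)} {t a : List (D → D)}
    (h : HaltsWithin k (.row ⊥ .noRows) (contents [] (i.reverse ++ w) t a) b) :
    HaltsWithin (k + i.length + 1) .reverse (contents i w t a) b := by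
  induction i generalizing w with
  | nil => exact h.of_step fun s => by simp [program]
  | cons x i ih =>
    refine HaltsWithin.of_step (ih (w := x :: w) ?_) fun s => by simp [program]
    simpa using h

theorem haltsWithin_clearTable {i w : List (Option D)} {t a : List (D → D)}
    (h : HaltsWithin k .reverse (contents i w [] a) b) :
    HaltsWithin (k + t.length + 1) .clearTable (contents i w t a) b := by
  induction t with
  | nil => exact h.of_step fun s => by simp [program]
  | cons x t ih => exact ih.of_step fun s => by simp [program]

theorem haltsWithin_restoreTable {A : AddSubgroup D} {st : Status} {i w : List (Option D)}
    {t a : List (D → D)} (h : HaltsWithin k (.row A st) (contents i w (a.reverseAux t) []) b) :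
    HaltsWithin (k + a.length + 1) (.restoreTable A st) (contents i w t a) b := by
  induction a generalizing t with
  | nil => exact h.of_step fun s => by simp [program]
  | cons x a ih => exact (ih h).of_step fun s => by simp [program]

theorem haltsWithin_answer_nil (b : Bool) :
    HaltsWithin 1 (.answer b) (contents ([] : List (Option D)) [] [] []) b :=
  fun s => ⟨⟨⟨1, congrArg some (by simp [program])⟩, le_rfl⟩⟩

theorem haltsWithin_answer (b : Bool) {i w : List (Option D)} {t a : List (D → D)}
    (hi : i.length ≤ k) (hw : w.length ≤ k) (ht : t.length ≤ k) (ha : a.length ≤ k) :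
    HaltsWithin (k + 1) (.answer b) (contents i w t a) b := by
  induction k generalizing i w t a with
  | zero =>
    simp only [Nat.le_zero, List.length_eq_zero_iff] at hi hw ht ha
    subst hi hw ht ha
    exact haltsWithin_answer_nil b
  | succ k ih =>
    by_cases hbit : (i.head?.isSome || w.head?.isSome || t.head?.isSome || a.head?.isSome) = true
    · refine (ih (i := i.tail) (w := w.tail) (t := t.tail) (a := a.tail) ?_ ?_ ?_ ?_).of_step
        fun s => by simp [program, hbit]
      all_goals simp only [List.length_tail]; omega
    · simp only [Bool.or_eq_true, List.isSome_head?, not_or, not_not] at hbit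
      obtain ⟨⟨⟨rfl, rfl⟩, rfl⟩, rfl⟩ := hbit
      exact (haltsWithin_answer_nil b).mono (by omega)

theorem haltsWithin_coeffs_cons {A : AddSubgroup D} {c d : D} {st : Status}
    {i w : List (Option D)} {t a : List (D → D)}
    (h : HaltsWithin k (.coeffs A c st) (contents (some (kernelVector A (t.headD 0) c d) :: i) w
      t.tail (extendSection A (t.headD 0) c d :: a)) b) :
    HaltsWithin (k + 1) (.coeffs A c st) (contents i (some d :: w) t a) b :=
  h.of_step fun s => by simp [program]

open Classical in
theorem haltsWithin_coeffs {A : AddSubgroup D} {c : D} {st : Status} {x : List D}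
    {i w : List (Option D)} {t a : List (D → D)}
    (h : HaltsWithin k (.row (A ⊔ AddSubgroup.zmultiples c) (st.addProper (decide (c ∈ A))))
      (contents (none :: (((kernelRow A c x t).map some).reverse ++ i)) w
        (a.reverseAux (extendTable A c x t)) []) b) :
    HaltsWithin (k + 2 * x.length + a.length + 2) (.coeffs A c st)
      (contents i (x.map some ++ none :: w) t a) b := by
  induction x generalizing i t a with
  | nil =>
    exact (haltsWithin_restoreTable h).of_step fun s => by
      simp [program, kernelRow, extendTable]
  | cons d x ih =>
    refine (haltsWithin_coeffs_cons (ih ?_)).mono ?_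
    · simpa [kernelRow, extendTable] using h
    · simp only [List.length_cons]; omega

theorem haltsWithin_coeffs_of_unterminated {A : AddSubgroup D} {c : D} {st : Status} {x : List D}
    {i : List (Option D)} {t a : List (D → D)} (hi : i.length + x.length ≤ k)
    (ht : t.length ≤ k) (ha : a.length + x.length ≤ k) :
    HaltsWithin (k + x.length + 2) (.coeffs A c st) (contents i (x.map some) t a) false := by
  induction x generalizing i t a with
  | nil =>
    exact (haltsWithin_answer (w := []) false hi k.zero_le ht ha).of_step fun s => by simp [program]
  | cons d x ih =>
    refine haltsWithin_coeffs_cons (ih ?_ ?_ ?_)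
    all_goals simp only [List.length_cons, List.length_tail] at *; omega

/-- A list of rows as a word, in which each row is followed by the symbol `none`. -/
def encode {D : Type*} : List (List D) → List (Option D)
  | [] => []
  | v :: vs => v.map some ++ none :: encode vs

theorem length_encode_cons {D : Type*} (v : List D) (vs : List (List D)) :
    (encode (v :: vs)).length = v.length + 1 + (encode vs).length := by
  simp only [encode, List.length_append, List.length_cons, List.length_map]
  omega

theorem length_le_length_encode {D : Type*} {vs : List (List D)} {v : List D} (hv : v ∈ vs) :
    v.length ≤ (encode vs).length := by
  induction vs with
  | nil => cases hv
  | cons u vs ih =>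
    rw [length_encode_cons]
    rcases List.mem_cons.1 hv with rfl | hv
    · omega
    · exact (ih hv).trans (Nat.le_add_left _ _)

theorem length_encode_sweep_add_countP (st : SweepState D) (vs : List (List D)) :
    (encode (st.sweep vs)).length + vs.countP (!·.isEmpty) = (encode vs).length := by
  induction vs generalizing st with
  | nil => rfl
  | cons v vs ih =>
    rw [sweep, length_encode_cons, length_encode_cons, length_reduce, ← ih (st.next v)]
    cases v with
    | nil => simp [add_assoc]
    | cons c x =>
      simp only [List.length_cons, Nat.add_one_sub_one, List.isEmpty_cons, Bool.not_false,
        List.countP_cons_of_pos]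
      omega

theorem haltsWithin_row {st : SweepState D} {vs : List (List D)} {i w : List (Option D)}
    (h : HaltsWithin k (.row (vs.foldl next st).group (vs.foldl next st).status)
      (contents ((encode (st.sweep vs)).reverse ++ i) w (vs.foldl next st).table []) b) :
    HaltsWithin (k + 3 * (encode vs).length) (.row st.group st.status)
      (contents i (encode vs ++ w) st.table []) b := by
  induction vs generalizing st i with
  | nil => exact h
  | cons v vs ih =>
    have htail := ih (st := st.next v) (i := none :: (((st.reduce v).map some).reverse ++ i))
      (by simpa [encode, sweep] using h)
    rw [length_encode_cons]
    cases v with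
    | nil =>
      refine (htail.of_step fun s => ?_).mono (by omega)
      simp [program, encode, next, reduce]
    | cons c x =>
      have hcoeffs := haltsWithin_coeffs (a := []) (st := st.status) htail
      refine (hcoeffs.of_step fun s => ?_).mono ?_
      · simp [program, encode]
      · simp only [List.length_cons, List.length_nil]; omega

theorem haltsWithin_reverse_encode {vs : List (List D)} {w : List (Option D)}
    (h : HaltsWithin k (.row (vs.foldl next start).group (vs.foldl next start).status)
      (contents (encode (start.sweep vs)).reverse w (vs.foldl next start).table []) b) :
    HaltsWithin (k + 4 * (encode vs).length + w.length + 1) .reverse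
      (contents (encode vs ++ w).reverse [] [] []) b := by
  refine (haltsWithin_reverse (k := k + 3 * (encode vs).length) ?_).mono ?_
  · rw [List.reverse_reverse, List.append_assoc, List.append_nil]
    exact haltsWithin_row (by rwa [List.append_nil])
  · simp only [List.length_reverse, List.length_append]; omega

theorem haltsWithin_row_nil {A : AddSubgroup D} {st : Status} {i : List (Option D)}
    {t a : List (D → D)}
    (h : HaltsWithin k (st.verdict.elim .clearTable .answer) (contents i [] t a) b) :
    HaltsWithin (k + 1) (.row A st) (contents i [] t a) b :=
  h.of_step fun s => by simp [program]

theorem length_table_le_length_encode (vs : List (List D)) :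
    (vs.foldl next start).table.length ≤ (encode vs).length :=
  length_table_foldl_le (Nat.zero_le _) fun _ hv => (length_le_length_encode hv).trans (by omega)

theorem haltsWithin_encode_of_verdict_eq_some {vs : List (List D)}
    (h : (vs.foldl next start).status.verdict = some b) :
    HaltsWithin (5 * (encode vs).length + 3) .reverse
      (contents (encode vs).reverse [] [] []) b := by
  have hrow : HaltsWithin ((encode vs).length + 1 + 1)
      (.row (vs.foldl next start).group (vs.foldl next start).status)
      (contents (encode (start.sweep vs)).reverse [] (vs.foldl next start).table []) b := by
    refine haltsWithin_row_nil ?_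
    rw [h]
    refine haltsWithin_answer b ?_ (Nat.zero_le _) (length_table_le_length_encode vs)
      (Nat.zero_le _)
    have := length_encode_sweep_add_countP start vs
    rw [List.length_reverse]
    omega
  have hreverse := haltsWithin_reverse_encode hrow
  rw [List.append_nil] at hreverse
  refine hreverse.mono ?_
  rw [List.length_nil]
  omega

theorem haltsWithin_encode_of_verdict_eq_none {vs : List (List D)}
    (h : (vs.foldl next start).status.verdict = none)
    (hsweep : HaltsWithin k .reverse (contents (encode (start.sweep vs)).reverse [] [] []) b) :
    HaltsWithin (k + 5 * (encode vs).length + 3) .reverse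
      (contents (encode vs).reverse [] [] []) b := by
  have hrow : HaltsWithin (k + (vs.foldl next start).table.length + 1 + 1)
      (.row (vs.foldl next start).group (vs.foldl next start).status)
      (contents (encode (start.sweep vs)).reverse [] (vs.foldl next start).table []) b := by
    refine haltsWithin_row_nil ?_
    rw [h]
    exact haltsWithin_clearTable hsweep
  have hreverse := haltsWithin_reverse_encode hrow
  rw [List.append_nil] at hreverse
  refine hreverse.mono ?_
  have := length_table_le_length_encode vs
  rw [List.length_nil]
  omega

theorem length_encode_sweep_lt {vs : List (List D)} {lastMem : Bool}
    (h : (vs.foldl next start).status = .properRows lastMem) :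
    (encode (start.sweep vs)).length < (encode vs).length := by
  have hfits := fits_foldl_next vs
  rw [h] at hfits
  obtain ⟨v, hv⟩ := List.exists_mem_of_ne_nil vs hfits.1
  have hpos : 0 < vs.countP (!·.isEmpty) :=
    List.countP_pos_iff.2 ⟨v, hv, by simpa using hfits.2 v hv⟩
  have := length_encode_sweep_add_countP start vs
  omega

theorem haltsWithin_encode {vs : List (List D)} (hb : b = true ↔ Solvable vs) :
    HaltsWithin (3 * ((encode vs).length + 1) ^ 2) .reverse
      (contents (encode vs).reverse [] [] []) b := by
  induction hn : (encode vs).length using Nat.strong_induction_on generalizing vs with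
  | _ n ih =>
    subst hn
    cases hverdict : (vs.foldl next start).status.verdict with
    | some b' =>
      obtain rfl : b = b' := by
        rw [Bool.eq_iff_iff, hb, solvable_iff_of_verdict_eq_some hverdict]
      exact (haltsWithin_encode_of_verdict_eq_some hverdict).mono (by nlinarith)
    | none =>
      have hst := Status.verdict_eq_none_iff.1 hverdict
      have hlt := length_encode_sweep_lt hst
      have hsweep := ih _ hlt (hb.trans (by simp [solvable_iff_of_properRows hst])) rfl
      exact (haltsWithin_encode_of_verdict_eq_none hverdict hsweep).mono (by nlinarith)

theorem haltsWithin_of_unterminated (vs : List (List D)) (c : D) (x : List D) :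
    HaltsWithin (5 * (encode vs ++ some c :: x.map some).length + 3) .reverse
      (contents (encode vs ++ some c :: x.map some).reverse [] [] []) false := by
  have hsweep := length_encode_sweep_add_countP start vs
  have hcoeffs := haltsWithin_coeffs_of_unterminated (A := (vs.foldl next start).group) (c := c)
    (st := (vs.foldl next start).status) (x := x) (a := [])
    (i := (encode (start.sweep vs)).reverse) (k := (encode vs).length + x.length)
    (by rw [List.length_reverse]; omega) ((length_table_le_length_encode vs).trans (by omega))
    (by simp)
  refine (haltsWithin_reverse_encode (hcoeffs.of_step fun s => by simp [program])).mono ?_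
  simp only [List.length_append, List.length_cons, List.length_map]
  omega

/-- The machine that runs `program`. -/
noncomputable def machine (D : Type) [AddCommGroup D] [Finite D] : FinTM2 :=
  have := Fintype.ofFinite D
  { K := Stack
    k₀ := .inp
    k₁ := .out
    Γ := Symbol D
    Λ := Label D
    main := .reverse
    ΛFin := Fintype.ofFinite _
    σ := Reg D
    initialState := {}
    σFin := Fintype.ofFinite _
    Γk₀Fin := (inferInstance : Fintype (Option D))
    m := program }

theorem initList_machine [Finite D] (w : List (Option D)) :
    initList (machine D) w = ⟨some .reverse, {}, contents w [] [] []⟩ := by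
  refine congrArg (TM2.Cfg.mk _ _) ?_
  funext k
  cases k <;> rfl

theorem haltList_machine [Finite D] (b : Bool) :
    haltList (machine D) [b] = ⟨none, {}, contents [] [] [] [] [b]⟩ := by
  refine congrArg (TM2.Cfg.mk _ _) ?_
  funext k
  cases k <;> rfl

theorem HaltsWithin.nonempty_outputsInTime [Finite D] {w : List (Option D)}
    (h : HaltsWithin k .reverse (contents w [] [] []) b) :
    Nonempty (TM2OutputsInTime (machine D) w (some [b]) k) := by
  change Nonempty (StateTransition.EvalsToInTime (machine D).step (initList (machine D) w)
    (some (haltList (machine D) [b])) k)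
  rw [initList_machine, haltList_machine]
  exact h {}

open Classical in
theorem inP_of_haltsWithin [Finite D] {L : Language (Option D)} {p : Polynomial ℕ}
    (h : ∀ w, HaltsWithin (D := D) (p.eval w.length) .reverse (contents w [] [] [])
      (decide (w ∈ L))) : InP L := by
  refine ⟨fun w => decide (w ∈ L), fun w => decide_eq_true_iff, ⟨?_⟩⟩
  exact
    { tm := machine D
      inputAlphabet := Equiv.refl (Option D)
      outputAlphabet := Equiv.refl Bool
      time := p
      outputsFun := fun w => Classical.choice <|
        HaltsWithin.nonempty_outputsInTime (w := w.map id) (by rw [List.map_id]; exact h w) }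

end Machine

section Language

variable {D : Type}

theorem exists_eq_encode_append (w : List (Option D)) :
    ∃ (vs : List (List D)) (ds : List D), w = encode vs ++ ds.map some := by
  induction w with
  | nil => exact ⟨[], [], rfl⟩
  | cons x w ih =>
    obtain ⟨vs, ds, rfl⟩ := ih
    match x, vs with
    | none, vs => exact ⟨[] :: vs, ds, rfl⟩
    | some d, [] => exact ⟨[], d :: ds, rfl⟩
    | some d, v :: vs => exact ⟨(d :: v) :: vs, ds, rfl⟩

theorem encode_append (us vs : List (List D)) : encode (us ++ vs) = encode us ++ encode vs := by
  induction us with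
  | nil => rfl
  | cons u us ih => simp [encode, ih]

/-- A vector as the row in which it stands on the stack `work`, where the input is read from its
end. -/
def row {n : ℕ} (v : Fin n → D) : List D := (List.ofFn v).reverse

theorem length_row {n : ℕ} (v : Fin n → D) : (row v).length = n := by
  simp [row]

theorem row_getElem_rev {n : ℕ} {x : List D} (h : x.length = n) :
    row (fun i : Fin n => x[i.rev]) = x := by
  subst h
  refine List.ext_getElem (length_row _) fun i h₁ h₂ => ?_
  simp only [row, Fin.getElem_fin, Fin.val_rev, List.getElem_reverse, List.length_ofFn,
    List.getElem_ofFn]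
  congr 1
  omega

theorem exists_eq_map_row {n : ℕ} {vs : List (List D)} (h : ∀ v ∈ vs, v.length = n) :
    ∃ l : List (Fin n → D), vs = l.map row := by
  induction vs with
  | nil => exact ⟨[], rfl⟩
  | cons v vs ih =>
    obtain ⟨hv, hvs⟩ := List.forall_mem_cons.1 h
    obtain ⟨l, rfl⟩ := ih hvs
    exact ⟨(fun i => v[i.rev]) :: l, by rw [List.map_cons, row_getElem_rev hv]⟩

theorem reverse_encodeVectors {n : ℕ} (l : List (Fin n → D)) :
    (encodeVectors l).reverse = encode (l.reverse.map row) := by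
  induction l with
  | nil => rfl
  | cons v l ih =>
    have hcons : encodeVectors (v :: l) = none :: (List.ofFn v).map some ++ encodeVectors l := rfl
    rw [hcons, List.reverse_append, ih, List.reverse_cons (as := l), List.map_append,
      encode_append]
    simp [encode, row]

variable [AddCommGroup D]

theorem toSeq_row {n : ℕ} (v : Fin n → D) (i : ℕ) :
    toSeq (row v) i = if h : i < n then v (Fin.rev ⟨i, h⟩) else 0 := by
  split_ifs with h
  · simp [toSeq, row, h, Fin.rev, Nat.sub_sub, add_comm]
  · simp [toSeq, row, h]

/-- `toSeq ∘ row` as a homomorphism. -/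
def rowHom (n : ℕ) : (Fin n → D) →+ (ℕ → D) where
  toFun v := toSeq (row v)
  map_zero' := by funext i; simp [toSeq_row]
  map_add' v w := by funext i; simp only [toSeq_row, Pi.add_apply]; split_ifs <;> simp

theorem rowHom_injective (n : ℕ) : Function.Injective (rowHom (D := D) n) := by
  intro v w h
  funext i
  have hi := congrFun h i.rev
  simpa only [rowHom, AddMonoidHom.coe_mk, ZeroHom.coe_mk, toSeq_row, Fin.is_lt, dif_pos, Fin.eta,
    Fin.rev_rev] using hi

theorem toSeq_row_mem_closure_iff {n : ℕ} {v : Fin n → D} {l : List (Fin n → D)} :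
    toSeq (row v) ∈ AddSubgroup.closure (toSeq '' {g | g ∈ l.map row}) ↔
      v ∈ AddSubgroup.closure {s | s ∈ l} := by
  have himage : toSeq '' {g | g ∈ l.map row} = rowHom n '' {s | s ∈ l} := by
    ext
    simp [rowHom]
  rw [himage, ← AddMonoidHom.map_closure]
  exact AddSubgroup.mem_map_iff_mem (rowHom_injective n)

theorem solvable_map_row_iff {n : ℕ} {v : Fin n → D} {l : List (Fin n → D)} :
    Solvable ((v :: l).reverse.map row) ↔ l ≠ [] ∧ v ∈ AddSubgroup.closure {s | s ∈ l} := by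
  rw [List.reverse_cons, List.map_append, List.map_singleton, solvable_append_singleton,
    toSeq_row_mem_closure_iff]
  simp [length_row]

theorem mem_closureProblem_add_iff [Finite D] {w : List (Option D)} :
    w ∈ closureProblem (clone {binaryOp ((· + ·) : D → D → D)}) ↔
      ∃ vs, w.reverse = encode vs ∧ Solvable vs := by
  have hCl {n : ℕ} {v : Fin n → D} {l : List (Fin n → D)} :
      v ∈ Cl (clone {binaryOp ((· + ·) : D → D → D)}) {s | s ∈ l} ↔
        Solvable ((v :: l).reverse.map row) := by
    rw [Cl_clone_add, SetLike.mem_coe, mem_addSubsemigroup_closure_iff, solvable_map_row_iff]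
    exact and_congr_left' ⟨fun ⟨_, hs⟩ => List.ne_nil_of_mem hs, List.exists_mem_of_ne_nil l⟩
  constructor
  · rintro ⟨n, v, l, rfl, hv⟩
    exact ⟨_, reverse_encodeVectors _, hCl.1 hv⟩
  · rintro ⟨vs, hw, hvs⟩
    obtain ⟨gens, t, rfl, -, hlen, -⟩ := id hvs
    obtain ⟨l, rfl⟩ := exists_eq_map_row hlen
    have hrows : l.map row ++ [t] =
        ((fun i : Fin t.length => t[i.rev]) :: l.reverse).reverse.map row := by
      rw [List.reverse_cons, List.reverse_reverse, List.map_append, List.map_singleton,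
        row_getElem_rev rfl]
    rw [hrows] at hw hvs
    refine ⟨_, _, _, ?_, hCl.2 hvs⟩
    rw [← List.reverse_inj, hw, reverse_encodeVectors]

open Classical in
theorem haltsWithin_decide_mem [Finite D] (w : List (Option D)) :
    HaltsWithin (3 * (w.length + 1) ^ 2) .reverse (contents w [] [] [])
      (decide (w ∈ closureProblem (clone {binaryOp ((· + ·) : D → D → D)}))) := by
  by_cases hmem : w ∈ closureProblem (clone {binaryOp ((· + ·) : D → D → D)})
  · obtain ⟨vs, hw, hvs⟩ := mem_closureProblem_add_iff.1 hmem
    obtain rfl := List.reverse_eq_iff.1 hw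
    simpa [hmem] using haltsWithin_encode (iff_of_true rfl hvs)
  obtain ⟨vs, ds, hw⟩ := exists_eq_encode_append w.reverse
  obtain rfl := List.reverse_eq_iff.1 hw
  rw [decide_eq_false hmem]
  cases ds with
  | nil =>
    have hvs : ¬Solvable vs := fun hvs =>
      hmem (mem_closureProblem_add_iff.2 ⟨vs, by simp, hvs⟩)
    simpa using haltsWithin_encode (b := false) (by simpa using hvs)
  | cons c x =>
    refine (haltsWithin_of_unterminated vs c x).mono ?_
    rw [List.length_reverse, List.map_cons]
    nlinarith

theorem closureProblem_add_inP [Finite D] :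
    InP (closureProblem (clone {binaryOp ((· + ·) : D → D → D)})) :=
  inP_of_haltsWithin (p := 3 * (Polynomial.X + 1) ^ 2) fun w => by
    simpa using haltsWithin_decide_mem w

end Language

end ClosureProblem

theorem mainTheorem9 {D : Type} [Finite D] (f : D → D → D)
    (hf : ClosureProblem.IsCommGroupOp f) :
    ClosureProblem.InP
      (ClosureProblem.closureProblem (ClosureProblem.clone {ClosureProblem.binaryOp f})) := by
  obtain ⟨assoc, comm, e, he, hinv⟩ := hf
  choose inv hinv using hinv
  let _ : Add D := ⟨f⟩
  let _ : Zero D := ⟨e⟩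
  let _ : Neg D := ⟨inv⟩
  let _ : AddCommGroup D := { AddGroup.ofLeftAxioms assoc he hinv with add_comm := comm }
  exact ClosureProblem.closureProblem_add_inP (D := D)
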